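/- Let $(\Omega,\mathcal F,\mathbb P_0)$ be a probability space, $X\in L^1(\mathbb P_0)$ real-valued, $r>0$, and let $\phi_1^*,\phi_2^*:\mathbb R\to\mathbb R$ be (finite everywhere, i.e. proper with full domain) non-decreasing convex functions with $\phi_i^*(0)=0$ and $\phi_i^*(s)>s$ for all $s\neq 0$, $i=1,2$. For $\lambda=0$ the expression $\lambda\phi_2^*(s/\lambda)$ means $0$ if $s\le 0$ and $+\infty$ if $s>0$. Consider the two problems $$(\mathrm P)\quad \inf_{\theta_1,\theta_2\in\mathbb R}\; -\theta_1-\theta_2+\mathbb E_{\mathbb P_0}\big[\phi_2^*(\phi_1^*(\theta_2-X)+\theta_1)\big],$$ $$(\mathrm B)\quad \inf_{\lambda\ge 0,\;\theta_1,\theta_2\in\mathbb R}\; -\theta_1-\theta_2+\lambda r+\mathbb E_{\mathbb P_0}\Big[\lambda\phi_2^*\Big(\frac{\phi_1^*(\theta_2-X)+\theta_1}{\lambda}\Big)\Big],$$ and, for i.i.d. random variables $X_1,X_2,\dots$ distributed as $X$ under $\mathbb P_0$, their sample average approximations $(\mathrm P_N)$, $(\mathrm B_N)$, in which $\mathbb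 E_{\mathbb P_0}[g(X)]$ is replaced by $\frac1N\sum_{i=1}^N g(X_i)$. Assume that there is a point $(\theta_1^0,\theta_2^0,\lambda_0)\in\mathbb R^2\times[0,\infty)$ such that $$\mathbb E_{\mathbb P_0}\Big[\lambda\phi_2^*\Big(\frac{\phi_1^*(\theta_2-X)+\theta_1}{\lambda}\Big)\Big]<\infty$$ for all $(\theta_1,\theta_2,\lambda)$ in a neighborhood of it in $\mathbb R^2\times[0,\infty)$. For a problem, write $S$ for its set of minimizers (the feasible points at which the objective is at most its value at every feasible point; if the objective is identically $+\infty$, every feasible point is a minimizer), $S_N$ for that of its sample average approximation, and $D(A,B)=\sup_{a\in A}\operatorname{dist}(a,B)$. Then: 1. With probability 1, as $N\to\infty$, the optimal value of $(\mathrm P_N)$ converges in $[-\infty,\infty]$ to that of $(\mathrm P)$. 2. For $(\mathrm P)$, $S\neq\emptyset$, and with probability 1, $S_N\ne\emptyset$ for all large $N$ and $D(S_N,S)\to 0$. 3. With probability 1, the optimal value of $(\mathrm B_N)$ converges to that of $(\mathrm B)$. 4. If moreover the function $(\lambda,s)\mapsto\lambda\phi_2^*(s/\lambda)$ is lower semicontinuous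 on $[0,\infty)\times\mathbb R$ (equivalently, $\phi_2^*(t)/t\to\infty$ as $t\to\infty$ and $\phi_2^*(t)/t\to 0$ as $t\to-\infty$), then for $(\mathrm B)$, $S\neq\emptyset$, and with probability 1, $S_N\ne\emptyset$ for all large $N$ and $D(S_N,S)\to0$. -/

import Mathlib

open MeasureTheory ProbabilityTheory Filter Topology
open scoped ENNReal

noncomputable section

/-- Expectation of an extended real valued function, `E[g⁺] - E[g⁻]`. It is used only for
integrands with integrable negative part, so that no difference `∞ - ∞` occurs. -/
def extExp {Ω : Type*} [MeasurableSpace Ω] (P : Measure Ω) (g : Ω → EReal) : EReal :=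
  ((∫⁻ ω, (g ω).toENNReal ∂P : ℝ≥0∞) : EReal) - ((∫⁻ ω, (-g ω).toENNReal ∂P : ℝ≥0∞) : EReal)

/-- Average of an extended real valued function over the first `N` sample points. -/
def sampleMean (x : ℕ → ℝ) (N : ℕ) (g : ℝ → EReal) : EReal :=
  (((N : ℝ)⁻¹ : ℝ) : EReal) * ∑ i ∈ Finset.range N, g (x i)

/-- `lam * φ (s / lam)`, with the convention `0 * φ (s / 0) = 0` for `s ≤ 0` and
`0 * φ (s / 0) = ∞` for `s > 0`. -/
def persp (φ : ℝ → ℝ) (lam s : ℝ) : EReal :=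
  if lam = 0 then (if s ≤ 0 then 0 else ⊤) else ((lam * φ (s / lam) : ℝ) : EReal)

/-- Objective of the penalized dual problem at `θ = (θ₁, θ₂)`. -/
def penObj {Ω : Type*} [MeasurableSpace Ω] (P : Measure Ω) (X : Ω → ℝ) (φ₁ φ₂ : ℝ → ℝ)
    (θ : ℝ × ℝ) : EReal :=
  ((-θ.1 - θ.2 : ℝ) : EReal) +
    extExp P (fun ω => ((φ₂ (φ₁ (θ.2 - X ω) + θ.1) : ℝ) : EReal))

/-- Sample average approximation of `penObj`. -/
def penObjSAA (x : ℕ → ℝ) (N : ℕ) (φ₁ φ₂ : ℝ → ℝ) (θ : ℝ × ℝ) : EReal :=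
  ((-θ.1 - θ.2 : ℝ) : EReal) +
    sampleMean x N (fun y => ((φ₂ (φ₁ (θ.2 - y) + θ.1) : ℝ) : EReal))

/-- Objective of the ball-constrained dual problem (radius `r`) at `z = (θ₁, θ₂, lam)`. -/
def ballObj {Ω : Type*} [MeasurableSpace Ω] (P : Measure Ω) (X : Ω → ℝ) (φ₁ φ₂ : ℝ → ℝ)
    (r : ℝ) (z : ℝ × ℝ × ℝ) : EReal :=
  ((-z.1 - z.2.1 + z.2.2 * r : ℝ) : EReal) +
    extExp P (fun ω => persp φ₂ z.2.2 (φ₁ (z.2.1 - X ω) + z.1))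

/-- Sample average approximation of `ballObj`. -/
def ballObjSAA (x : ℕ → ℝ) (N : ℕ) (φ₁ φ₂ : ℝ → ℝ) (r : ℝ) (z : ℝ × ℝ × ℝ) : EReal :=
  ((-z.1 - z.2.1 + z.2.2 * r : ℝ) : EReal) +
    sampleMean x N (fun y => persp φ₂ z.2.2 (φ₁ (z.2.1 - y) + z.1))

/-- The feasible set `ℝ × ℝ × [0, ∞)` of the ball-constrained dual problem. -/
def ballFeas : Set (ℝ × ℝ × ℝ) := {z | 0 ≤ z.2.2}

/-- Optimal value of `min_{x ∈ C} f x`. -/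
def optVal {E : Type*} (C : Set E) (f : E → EReal) : EReal := ⨅ x ∈ C, f x

/-- Set of optimal solutions of `min_{x ∈ C} f x`. -/
def optSol {E : Type*} (C : Set E) (f : E → EReal) : Set E := {x ∈ C | ∀ y ∈ C, f x ≤ f y}

/-- Deviation `sup_{x ∈ A} dist(x, B)` of the set `A` from the set `B`. -/
def setDev {E : Type*} [PseudoEMetricSpace E] (A B : Set E) : ℝ≥0∞ :=
  ⨆ x ∈ A, Metric.infEDist x B

end

/-!
Both problems have the form `min_{z ∈ C} a z + E[G z X]` with `a` continuous, and three properties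
of the integrand carry the whole proof (`IsCoerciveProgram`).

* Coercivity. A convex function that touches the identity only at `0` exceeds it by a linear amount
  (`exists_linear_growth`). Hence `a z + G z y ≥ k ‖z‖ - b (1 + |y|)` with `k > 0`
  (`exists_persp_coercive`), and since the means of `|ξ i|` converge, the sublevel sets at a
  given real level lie in one fixed ball, for the problem and eventually for its sample averages.
* Monotonicity. `G` is nondecreasing in `θ₁, θ₂` and, because `φ₂` is convex with `φ₂ 0 = 0`, the
  perspective is nonincreasing in `lam` on all of `[0, ∞)` (`persp_antitone`). So at a feasible `c`
  slightly on the decreasing side of `z`, the function `G c` minorizes every `G z'` with `z'` near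
  `z`. The infimum of the integrand over a neighborhood, as used in Wald's consistency argument, is
  thereby replaced by the integrand at another feasible point, which may be taken in a countable
  dense set.
* A lower bound that is integrable at each `z`, so that the strong law of large numbers holds for
  each `G c`, also with mean `⊤` (`tendsto_sampleMean`).

For the optimal values, the objective at each such `c` is at least the optimal value, and
compactness of the ball gives the lower bound on the optimal values of the sample averages; the
upper bound is the law of large numbers along a minimizing sequence. No semicontinuity is used,
which is why the values converge even where the perspective is not lower semicontinuous at
`lam = 0`. For the solutions, lower semicontinuity of the integrand passes to the objective by
Fatou's lemma, so the objective exceeds its minimum near each point away from the solution set, and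
the same compactness argument excludes such points as solutions of the sample averages.
-/

/-! ### Expectations of extended real valued functions -/

section Expectation

variable {Ω : Type*} [MeasurableSpace Ω] {P : Measure Ω} {g g' : Ω → EReal} {ℓ : Ω → ℝ}

/-- Adding an integrable `ℓ ≥ g⁻` turns the extended expectation into a lower Lebesgue integral, so
that the convergence theorems for the latter become available. -/
theorem extExp_eq_lintegral_sub (hg : AEMeasurable g P) (hℓ : Integrable ℓ P) (hℓ0 : ∀ ω, 0 ≤ ℓ ω)
    (hle : ∀ ω, ((-ℓ ω : ℝ) : EReal) ≤ g ω) :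
    extExp P g = ((∫⁻ ω, (g ω + (ℓ ω : EReal)).toENNReal ∂P : ℝ≥0∞) : EReal)
      - ((∫ ω, ℓ ω ∂P : ℝ) : EReal) := by
  have hpt : ∀ ω, (g ω + (ℓ ω : EReal)).toENNReal + (-g ω).toENNReal
      = (g ω).toENNReal + ENNReal.ofReal (ℓ ω) := by
    intro ω
    have h1 := hle ω
    have h0 := hℓ0 ω
    generalize g ω = y at h1
    generalize ℓ ω = l at h1 h0
    induction y with
    | bot => simp at h1
    | top => simp
    | coe y =>
      rw [EReal.coe_le_coe_iff] at h1
      rw [← EReal.coe_add, ← EReal.coe_neg]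
      simp only [EReal.real_coe_toENNReal]
      rcases le_total 0 y with hy | hy
      · rw [ENNReal.ofReal_of_nonpos (by linarith : -y ≤ 0), add_zero, ENNReal.ofReal_add hy h0]
      · rw [ENNReal.ofReal_of_nonpos hy, zero_add,
          ← ENNReal.ofReal_add (by linarith) (by linarith)]
        congr 1; ring
  have hsum : (∫⁻ ω, (g ω + (ℓ ω : EReal)).toENNReal ∂P) + ∫⁻ ω, (-g ω).toENNReal ∂P
      = (∫⁻ ω, (g ω).toENNReal ∂P) + ENNReal.ofReal (∫ ω, ℓ ω ∂P) := by
    rw [ofReal_integral_eq_lintegral_ofReal hℓ (ae_of_all _ hℓ0),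
      ← lintegral_add_right' _
        (show AEMeasurable (fun ω => (-g ω).toENNReal) P from hg.neg.ereal_toENNReal),
      ← lintegral_add_right' _ hℓ.aemeasurable.ennreal_ofReal]
    exact lintegral_congr hpt
  have hfin : ∫⁻ ω, (-g ω).toENNReal ∂P ≠ ∞ := by
    refine ne_top_of_le_ne_top (b := ENNReal.ofReal (∫ ω, ℓ ω ∂P)) ENNReal.ofReal_ne_top ?_
    rw [ofReal_integral_eq_lintegral_ofReal hℓ (ae_of_all _ hℓ0)]
    refine lintegral_mono fun ω => ?_
    rw [← EReal.real_coe_toENNReal]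
    refine EReal.toENNReal_le_toENNReal ?_
    rw [EReal.neg_le]
    exact_mod_cast hle ω
  have hI : 0 ≤ ∫ ω, ℓ ω ∂P := integral_nonneg hℓ0
  unfold extExp
  generalize (∫⁻ ω, (g ω + (ℓ ω : EReal)).toENNReal ∂P) = A at *
  generalize (∫⁻ ω, (-g ω).toENNReal ∂P) = B at *
  generalize (∫⁻ ω, (g ω).toENNReal ∂P) = D at *
  generalize (∫ ω, ℓ ω ∂P) = I at *
  lift B to NNReal using hfin
  induction A with
  | top =>
    have : D = ⊤ := by
      by_contra h
      have : D + ENNReal.ofReal I ≠ ⊤ := ENNReal.add_ne_top.2 ⟨h, ENNReal.ofReal_ne_top⟩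
      rw [← hsum] at this
      simp at this
    subst this
    simp
  | coe A =>
    have : D ≠ ⊤ := by
      rintro rfl
      rw [top_add] at hsum
      exact (ENNReal.add_ne_top.2 ⟨ENNReal.coe_ne_top, ENNReal.coe_ne_top⟩) hsum
    lift D to NNReal using this
    have h2 : (A : ℝ) + B = D + I := by
      have := congrArg ENNReal.toReal hsum
      rwa [ENNReal.toReal_add (by simp) (by simp), ENNReal.toReal_add (by simp) (by simp),
        ENNReal.toReal_ofReal hI] at this
    have h3 : (D : ℝ) - B = A - I := by linarith
    exact congrArg Real.toEReal h3

theorem extExp_mono (h : ∀ ω, g ω ≤ g' ω) : extExp P g ≤ extExp P g' := by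
  unfold extExp
  refine EReal.sub_le_sub ?_ ?_
  · exact EReal.coe_ennreal_le_coe_ennreal_iff.2
      (lintegral_mono fun ω => EReal.toENNReal_le_toENNReal (h ω))
  · exact EReal.coe_ennreal_le_coe_ennreal_iff.2
      (lintegral_mono fun ω => EReal.toENNReal_le_toENNReal (EReal.neg_le_neg_iff.2 (h ω)))

theorem extExp_coe {h : Ω → ℝ} (hh : Integrable h P) :
    extExp P (fun ω => (h ω : EReal)) = ((∫ ω, h ω ∂P : ℝ) : EReal) := by
  rw [integral_eq_lintegral_pos_part_sub_lintegral_neg_part hh]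
  unfold extExp
  have h1 : ∫⁻ ω, ENNReal.ofReal (h ω) ∂P ≠ ∞ := by
    refine ne_top_of_le_ne_top hh.2.ne (lintegral_mono fun ω => ?_)
    exact Real.ofReal_le_enorm _
  have h2 : ∫⁻ ω, ENNReal.ofReal (-h ω) ∂P ≠ ∞ := by
    refine ne_top_of_le_ne_top hh.2.ne (lintegral_mono fun ω => ?_)
    rw [← enorm_neg]
    exact Real.ofReal_le_enorm _
  simp only [← EReal.coe_neg, EReal.real_coe_toENNReal]
  lift (∫⁻ ω, ENNReal.ofReal (h ω) ∂P) to NNReal using h1 with A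
  lift (∫⁻ ω, ENNReal.ofReal (-h ω) ∂P) to NNReal using h2 with B
  rfl

theorem extExp_congr_ae (h : g =ᵐ[P] g') : extExp P g = extExp P g' := by
  unfold extExp
  have h1 : ∫⁻ ω, (g ω).toENNReal ∂P = ∫⁻ ω, (g' ω).toENNReal ∂P :=
    lintegral_congr_ae (h.fun_comp EReal.toENNReal)
  have h2 : ∫⁻ ω, (-g ω).toENNReal ∂P = ∫⁻ ω, (-g' ω).toENNReal ∂P :=
    lintegral_congr_ae (h.fun_comp fun y => (-y).toENNReal)
  rw [h1, h2]

/-- An integrand with integrable lower bound and expectation `< ⊤` is almost surely the coercion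
of an integrable real function. -/
theorem integrable_of_extExp_lt_top (hg : AEMeasurable g P) (hℓ : Integrable ℓ P)
    (hℓ0 : ∀ ω, 0 ≤ ℓ ω) (hle : ∀ ω, ((-ℓ ω : ℝ) : EReal) ≤ g ω) (hlt : extExp P g < ⊤) :
    (∀ᵐ ω ∂P, g ω ≠ ⊤) ∧ Integrable (fun ω => (g ω).toReal) P := by
  rw [extExp_eq_lintegral_sub hg hℓ hℓ0 hle] at hlt
  have hmeas : AEMeasurable (fun ω => (g ω + (ℓ ω : EReal)).toENNReal) P :=
    (hg.add hℓ.aemeasurable.coe_real_ereal).ereal_toENNReal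
  have hA : ∫⁻ ω, (g ω + (ℓ ω : EReal)).toENNReal ∂P ≠ ∞ := by
    intro h
    rw [h] at hlt
    exact absurd hlt (by simp)
  have hae : ∀ᵐ ω ∂P, g ω ≠ ⊤ := by
    filter_upwards [ae_lt_top' hmeas hA] with ω hω htop
    rw [htop] at hω
    simp at hω
  refine ⟨hae, ?_⟩
  have hint := (integrable_toReal_of_lintegral_ne_top hmeas hA).sub hℓ
  refine hint.congr ?_
  filter_upwards [hae] with ω hω
  have h1 := hle ω
  simp only [Pi.sub_apply]
  generalize g ω = y at *
  generalize ℓ ω = l at *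
  induction y with
  | bot => simp at h1
  | top => exact absurd rfl hω
  | coe y =>
    rw [EReal.coe_le_coe_iff] at h1
    rw [← EReal.coe_add, EReal.real_coe_toENNReal, ENNReal.toReal_ofReal (by linarith),
      EReal.toReal_coe]
    ring

/-- Fatou's lemma for extended expectations with a common integrable lower bound. -/
theorem extExp_le_of_le_liminf {g_ : ℕ → Ω → EReal} {α : ℝ}
    (hm : ∀ n, AEMeasurable (g_ n) P) (hg : AEMeasurable g P)
    (hℓ : Integrable ℓ P) (hℓ0 : ∀ ω, 0 ≤ ℓ ω)
    (hle : ∀ n ω, ((-ℓ ω : ℝ) : EReal) ≤ g_ n ω)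
    (hleg : ∀ ω, ((-ℓ ω : ℝ) : EReal) ≤ g ω)
    (hlim : ∀ ω, ∀ β < g ω, ∀ᶠ n in atTop, β < g_ n ω)
    (hα : ∀ n, extExp P (g_ n) ≤ α) : extExp P g ≤ α := by
  have hle' : ∀ n, ((∫⁻ ω, (g_ n ω + (ℓ ω : EReal)).toENNReal ∂P : ℝ≥0∞) : EReal)
      ≤ ((α + ∫ ω, ℓ ω ∂P : ℝ) : EReal) := by
    intro n
    have h := hα n
    rw [extExp_eq_lintegral_sub (hm n) hℓ hℓ0 (hle n),
      EReal.sub_le_iff_le_add (.inr (EReal.coe_ne_top _)) (.inr (EReal.coe_ne_bot _))] at h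
    exact_mod_cast h
  have hn : ∀ n, ∫⁻ ω, (g_ n ω + (ℓ ω : EReal)).toENNReal ∂P
      ≤ ENNReal.ofReal (α + ∫ ω, ℓ ω ∂P) := by
    intro n
    have h := EReal.toENNReal_le_toENNReal (hle' n)
    rwa [EReal.toENNReal_coe, EReal.real_coe_toENNReal] at h
  have h0 : 0 ≤ α + ∫ ω, ℓ ω ∂P :=
    EReal.coe_nonneg.1 ((EReal.coe_ennreal_nonneg _).trans (hle' 0))
  have hpt : ∀ ω, (g ω + (ℓ ω : EReal)).toENNReal
      ≤ liminf (fun n => (g_ n ω + (ℓ ω : EReal)).toENNReal) atTop := by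
    intro ω
    refine le_of_forall_lt_imp_le_of_dense fun c hc => le_liminf_of_le (by isBoundedDefault) ?_
    have hc' : (c : EReal) < g ω + (ℓ ω : EReal) := by
      by_contra! h
      have := EReal.toENNReal_le_toENNReal h
      rw [EReal.toENNReal_coe] at this
      exact absurd hc (not_lt.2 this)
    filter_upwards [hlim ω _ (EReal.sub_lt_of_lt_add hc')] with n hn
    have h3 : (c : EReal) < g_ n ω + (ℓ ω : EReal) := by
      rwa [EReal.sub_lt_iff (.inl (EReal.coe_ne_bot _)) (.inl (EReal.coe_ne_top _))] at hn
    have := EReal.toENNReal_le_toENNReal h3.le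
    rwa [EReal.toENNReal_coe] at this
  have hF : ∫⁻ ω, (g ω + (ℓ ω : EReal)).toENNReal ∂P ≤ ENNReal.ofReal (α + ∫ ω, ℓ ω ∂P) := by
    refine (lintegral_mono hpt).trans ((lintegral_liminf_le' fun n =>
      ((hm n).add hℓ.aemeasurable.coe_real_ereal).ereal_toENNReal).trans ?_)
    exact liminf_le_of_le (by isBoundedDefault) fun b hb => by
      obtain ⟨n, h⟩ := hb.exists
      exact h.trans (hn n)
  rw [extExp_eq_lintegral_sub hg hℓ hℓ0 hleg,
    EReal.sub_le_iff_le_add (.inr (EReal.coe_ne_top _)) (.inr (EReal.coe_ne_bot _)),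
    ← EReal.coe_add]
  refine (EReal.coe_ennreal_le_coe_ennreal_iff.2 hF).trans ?_
  rw [EReal.coe_ennreal_ofReal, max_eq_left h0]

end Expectation

/-! ### Sample means -/

section SampleMean

theorem sampleMean_mono {x : ℕ → ℝ} {N : ℕ} {g g' : ℝ → EReal} (h : ∀ i, g (x i) ≤ g' (x i)) :
    sampleMean x N g ≤ sampleMean x N g' :=
  mul_le_mul_of_nonneg_left (Finset.sum_le_sum fun i _ => h i)
    (EReal.coe_nonneg.2 (by positivity))

theorem sampleMean_coe (x : ℕ → ℝ) (N : ℕ) (h : ℝ → ℝ) :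
    sampleMean x N (fun y => (h y : EReal))
      = (((∑ i ∈ Finset.range N, h (x i)) / N : ℝ) : EReal) := by
  have hs : ∑ i ∈ Finset.range N, (h (x i) : EReal)
      = ((∑ i ∈ Finset.range N, h (x i) : ℝ) : EReal) := by
    induction N with
    | zero => simp
    | succ n ih => rw [Finset.sum_range_succ, Finset.sum_range_succ, ih, EReal.coe_add]
  rw [sampleMean, hs, ← EReal.coe_mul, div_eq_inv_mul]

theorem lowerSemicontinuousOn_ereal_add {E : Type*} [TopologicalSpace E] {C : Set E}
    {f g : E → EReal} (hf : LowerSemicontinuousOn f C) (hg : LowerSemicontinuousOn g C) :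
    LowerSemicontinuousOn (fun z => f z + g z) C := by
  intro z hz
  by_cases h1 : f z = ⊥
  · exact fun y hy => by simp [h1] at hy
  by_cases h2 : g z = ⊥
  · exact fun y hy => by simp [h2] at hy
  exact LowerSemicontinuousWithinAt.add' (hf z hz) (hg z hz) (EReal.continuousAt_add (.inr h2) (.inl h1))

theorem lowerSemicontinuousOn_sampleMean {E : Type*} [TopologicalSpace E] {C : Set E}
    {G : E → ℝ → EReal} (hG : ∀ y, LowerSemicontinuousOn (fun z => G z y) C) (x : ℕ → ℝ)
    {N : ℕ} (hN : N ≠ 0) : LowerSemicontinuousOn (fun z => sampleMean x N (G z)) C := by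
  have hsum : ∀ n : ℕ,
      LowerSemicontinuousOn (fun z => ∑ i ∈ Finset.range n, G z (x i)) C := by
    intro n
    induction n with
    | zero => simpa using lowerSemicontinuousOn_const
    | succ n ih =>
      simp only [Finset.sum_range_succ]
      exact lowerSemicontinuousOn_ereal_add ih (hG _)
  have hpos : (0 : ℝ) < (N : ℝ)⁻¹ := by positivity
  refine Continuous.comp_lowerSemicontinuousOn (g := fun y : EReal => (((N : ℝ)⁻¹ : ℝ) : EReal) * y)
    ?_ (hsum N) ?_
  · refine continuous_iff_continuousAt.2 fun y => ?_
    exact EReal.Tendsto.const_mul tendsto_id (.inl (EReal.coe_ne_bot _))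
      (.inl (EReal.coe_ne_top _))
  · exact fun a b hab => mul_le_mul_of_nonneg_left hab (EReal.coe_nonneg.2 hpos.le)

end SampleMean

/-! ### A strong law of large numbers for integrands bounded below -/

section LargeNumbers

variable {Ω Ω' : Type*} [MeasurableSpace Ω] [MeasurableSpace Ω'] {P : Measure Ω}
  {μ : Measure Ω'} {X : Ω → ℝ} {ξ : ℕ → Ω' → ℝ}

theorem tendsto_sampleMean_coe (hindep : iIndepFun ξ μ) (hident : ∀ i, IdentDistrib (ξ i) X μ P)
    {h : ℝ → ℝ} (hm : Measurable h) (hint : Integrable (fun ω => h (X ω)) P) :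
    ∀ᵐ ω ∂μ, Tendsto (fun N : ℕ => sampleMean (fun i => ξ i ω) N (fun y => (h y : EReal))) atTop
      (𝓝 ((∫ ω, h (X ω) ∂P : ℝ) : EReal)) := by
  have hid : ∀ i, IdentDistrib (h ∘ ξ i) (h ∘ X) μ P := fun i => (hident i).comp hm
  have hlln := strong_law_ae_real (fun i => h ∘ ξ i) ((hid 0).integrable_iff.2 hint)
    (fun i j hij => (hindep.comp (fun _ => h) fun _ => hm).indepFun hij)
    (fun i => (hid i).trans (hid 0).symm)
  filter_upwards [hlln] with ω hω
  simp only [sampleMean_coe]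
  rw [EReal.tendsto_coe]
  rw [(hid 0).integral_eq] at hω
  exact hω

/-- The strong law of large numbers for an extended real valued integrand with integrable lower
bound. When the expectation is `⊤`, the law is applied to the truncations `min g n`, whose
expectations tend to `⊤` by Fatou's lemma. -/
theorem tendsto_sampleMean [IsFiniteMeasure P] (hindep : iIndepFun ξ μ)
    (hident : ∀ i, IdentDistrib (ξ i) X μ P) {g : ℝ → EReal} {ℓ : ℝ → ℝ} (hg : Measurable g) (hℓ0 : ∀ y, 0 ≤ ℓ y)
    (hℓ : Integrable (fun ω => ℓ (X ω)) P) (hle : ∀ y, ((-ℓ y : ℝ) : EReal) ≤ g y) :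
    ∀ᵐ ω ∂μ, Tendsto (fun N : ℕ => sampleMean (fun i => ξ i ω) N g) atTop
      (𝓝 (extExp P fun ω => g (X ω))) := by
  have hX : AEMeasurable X P := (hident 0).aemeasurable_snd
  have hgX : AEMeasurable (fun ω => g (X ω)) P := hg.comp_aemeasurable hX
  have hbot : ∀ y, g y ≠ ⊥ := fun y h => by simpa [h] using hle y
  rcases (le_top (a := extExp P fun ω => g (X ω))).lt_or_eq with hlt | htop
  · obtain ⟨hfin, hint⟩ := integrable_of_extExp_lt_top hgX hℓ (fun ω => hℓ0 _) (fun ω => hle _) hlt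
    have hset : MeasurableSet {y | g y ≠ ⊤} := (hg (measurableSet_singleton ⊤)).compl
    have hall : ∀ᵐ ω ∂μ, ∀ i, g (ξ i ω) ≠ ⊤ :=
      ae_all_iff.2 fun i => (hident i).symm.ae_snd (p := fun y => g y ≠ ⊤) hset hfin
    have hval : extExp P (fun ω => g (X ω)) = ((∫ ω, (g (X ω)).toReal ∂P : ℝ) : EReal) := by
      rw [← extExp_coe hint]
      refine extExp_congr_ae ?_
      filter_upwards [hfin] with ω hω
      rw [EReal.coe_toReal hω (hbot _)]
    rw [hval]
    filter_upwards [hall, tendsto_sampleMean_coe hindep hident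
      (h := fun y => (g y).toReal) hg.ereal_toReal hint] with ω hω ht
    refine ht.congr fun N => ?_
    unfold sampleMean
    congr 1
    exact Finset.sum_congr rfl fun i _ => EReal.coe_toReal (hω i) (hbot _)
  · let h : ℕ → ℝ → ℝ := fun n y => (min (g y) (n : ℝ)).toReal
    have hcoe : ∀ n y, ((h n y : ℝ) : EReal) = min (g y) ((n : ℝ) : EReal) := fun n y =>
      EReal.coe_toReal (ne_top_of_le_ne_top (EReal.coe_ne_top _) (min_le_right _ _))
        (by rcases min_choice (g y) ((n : ℝ) : EReal) with h | h <;> rw [h]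
            exacts [hbot y, EReal.coe_ne_bot _])
    have hhm : ∀ n, Measurable (h n) := fun n => (hg.min measurable_const).ereal_toReal
    have hlow : ∀ n y, -ℓ y ≤ h n y := by
      intro n y
      rw [← EReal.coe_le_coe_iff, hcoe]
      refine le_min (hle y) (EReal.coe_le_coe_iff.2 ?_)
      have := hℓ0 y
      linarith [Nat.cast_nonneg (α := ℝ) n]
    have hint : ∀ n, Integrable (fun ω => h n (X ω)) P := by
      intro n
      refine Integrable.mono' (hℓ.add (integrable_const (n : ℝ)))
        ((hhm n).comp_aemeasurable hX).aestronglyMeasurable (ae_of_all _ fun ω => ?_)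
      have h1 := hlow n (X ω)
      have h2 : h n (X ω) ≤ n := by
        rw [← EReal.coe_le_coe_iff, hcoe]
        exact min_le_right _ _
      have h3 := hℓ0 (X ω)
      rw [Real.norm_eq_abs, abs_le]
      simp only [Pi.add_apply]
      constructor <;> linarith [Nat.cast_nonneg (α := ℝ) n]
    have hunb : ∀ M : ℝ, ∃ n, M < ∫ ω, h n (X ω) ∂P := by
      intro M
      by_contra! hM
      have := extExp_le_of_le_liminf (P := P) (g := fun ω => g (X ω))
        (g_ := fun n ω => ((h n (X ω) : ℝ) : EReal)) (ℓ := fun ω => ℓ (X ω)) (α := M)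
        (fun n => (((hhm n).comp_aemeasurable hX)).coe_real_ereal) hgX hℓ (fun ω => hℓ0 _)
        (fun n ω => EReal.coe_le_coe_iff.2 (hlow n _)) (fun ω => hle _) ?_ ?_
      · rw [htop] at this
        simp at this
      · intro ω β hβ
        obtain ⟨b, hb, -⟩ := EReal.lt_iff_exists_real_btwn.1 (hβ.trans_le le_top)
        filter_upwards [eventually_ge_atTop ⌈b⌉₊] with n hn
        rw [hcoe]
        exact lt_min hβ (hb.trans_le (EReal.coe_le_coe_iff.2 (Nat.ceil_le.1 hn)))
      · intro n
        rw [extExp_coe (hint n)]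
        exact EReal.coe_le_coe_iff.2 (hM n)
    rw [htop]
    filter_upwards [ae_all_iff.2 fun n => tendsto_sampleMean_coe hindep hident (hhm n) (hint n)]
      with ω hω
    rw [EReal.tendsto_nhds_top_iff_real]
    intro M
    obtain ⟨n, hn⟩ := hunb M
    filter_upwards [(hω n).eventually_const_lt (EReal.coe_lt_coe_iff.2 hn)] with N hN
    refine hN.trans_le (sampleMean_mono fun i => ?_)
    rw [hcoe]
    exact min_le_left _ _

end LargeNumbers

/-! ### Existence of minimizers and local-to-uniform bounds -/

section Optimization

/-- The direct method for extended real valued functions. If `F` is `⊤` throughout `C`, every point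
of `C` is a minimizer. -/
theorem optSol_nonempty_of_lowerSemicontinuousOn {E : Type*} [NormedAddCommGroup E] [ProperSpace E]
    {C : Set E} {F : E → EReal} (hC : IsClosed C) (hne : C.Nonempty)
    (hF : LowerSemicontinuousOn F C)
    (hcoer : ∀ M : ℝ, ∃ R : ℝ, ∀ z ∈ C, R < ‖z‖ → (M : EReal) < F z) :
    (optSol C F).Nonempty := by
  by_cases htop : ∃ z ∈ C, F z < ⊤
  · obtain ⟨z₀, hz₀, hlt⟩ := htop
    obtain ⟨M, hM, -⟩ := EReal.lt_iff_exists_real_btwn.1 hlt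
    obtain ⟨R, hR⟩ := hcoer M
    have hz₀R : z₀ ∈ C ∩ Metric.closedBall 0 R :=
      ⟨hz₀, mem_closedBall_zero_iff.2 (not_lt.1 fun h => (hM.trans (hR z₀ hz₀ h)).false)⟩
    obtain ⟨z, hz, hmin⟩ := (hF.mono Set.inter_subset_left).exists_isMinOn ⟨z₀, hz₀R⟩
      ((isCompact_closedBall (0 : E) R).inter_left hC)
    refine ⟨z, hz.1, fun y hy => ?_⟩
    by_cases hyR : R < ‖y‖
    · exact ((hmin hz₀R).trans_lt (hM.trans (hR y hy hyR))).le
    · exact hmin ⟨hy, mem_closedBall_zero_iff.2 (not_lt.1 hyR)⟩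
  · push Not at htop
    obtain ⟨z, hz⟩ := hne
    exact ⟨z, hz, fun y hy => le_top.trans (htop y hy)⟩

theorem IsCompact.eventually_forall_of_local {E : Type*} [TopologicalSpace E] {K C : Set E}
    (hK : IsCompact K) (hKC : K ⊆ C) {Q : ℕ → E → Prop}
    (h : ∀ z ∈ K, ∃ U ∈ 𝓝[C] z, ∀ᶠ N in atTop, ∀ z' ∈ U, Q N z') :
    ∀ᶠ N in atTop, ∀ z ∈ K, Q N z := by
  refine hK.induction_on (p := fun s => ∀ᶠ N in atTop, ∀ z ∈ s, Q N z) (by simp)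
    (fun s t hst ht => ht.mono fun N hN z hz => hN z (hst hz))
    (fun s t hs ht => ?_) (fun z hz => ?_)
  · filter_upwards [hs, ht] with N h1 h2 z hz
    exact hz.elim (h1 z) (h2 z)
  · obtain ⟨U, hU, hU'⟩ := h z hz
    exact ⟨U, nhdsWithin_mono z hKC hU, hU'⟩

end Optimization

/-! ### Coercive stochastic programs with monotone integrands -/

section Program

variable {E : Type*} [NormedAddCommGroup E]

/-- Data of a problem `min_{z ∈ C} a z + E[G z X]`. The integrand is assumed coercive in `z` up to
a multiple of `1 + |y|`, and every feasible point is a limit of an open set of feasible points `c`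
at each of which `G c` minorizes `G z'` for all feasible `z'` near `z`. For an
integrand that is monotone in every coordinate, such `c` are the points strictly on the decreasing
side of `z`. -/
structure IsCoerciveProgram (C : Set E) (a : E → ℝ) (G : E → ℝ → EReal) : Prop where
  isClosed : IsClosed C
  nonempty : C.Nonempty
  continuous : Continuous a
  measurable : ∀ z ∈ C, Measurable (G z)
  coercive : ∃ k > 0, ∃ b ≥ 0, ∀ z ∈ C, ∀ y,
    ((k * ‖z‖ - b * (1 + |y|) - a z : ℝ) : EReal) ≤ G z y
  minorant : ∀ z ∈ C, ∃ W, IsOpen W ∧ z ∈ closure W ∧ W ⊆ C ∧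
    ∀ c ∈ W, ∀ᶠ z' in 𝓝[C] z, ∀ y, G c y ≤ G z' y

/-- The objective `a z + E[G z X]`. -/
noncomputable def programObj {Ω : Type*} [MeasurableSpace Ω] (P : Measure Ω) (X : Ω → ℝ) (a : E → ℝ)
    (G : E → ℝ → EReal) (z : E) : EReal :=
  (a z : EReal) + extExp P (fun ω => G z (X ω))

/-- The sample average approximation of `programObj`. -/
noncomputable def programSAA (x : ℕ → ℝ) (N : ℕ) (a : E → ℝ) (G : E → ℝ → EReal) (z : E) : EReal :=
  (a z : EReal) + sampleMean x N (G z)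

theorem tendsto_ereal_const_add {ι : Type*} {l : Filter ι} {f : ι → EReal} {e : EReal} (r : ℝ)
    (h : Tendsto f l (𝓝 e)) : Tendsto (fun i => (r : EReal) + f i) l (𝓝 ((r : EReal) + e)) :=
  (EReal.continuousAt_add (p := ((r : EReal), e)) (.inl (EReal.coe_ne_top _))
    (.inl (EReal.coe_ne_bot _))).tendsto.comp (tendsto_const_nhds.prodMk_nhds h)

namespace IsCoerciveProgram

variable {C : Set E} {a : E → ℝ} {G : E → ℝ → EReal} {Ω : Type*} [MeasurableSpace Ω]
  {P : Measure Ω} {X : Ω → ℝ}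

theorem exists_programSAA_ge (h : IsCoerciveProgram C a G) :
    ∃ k > 0, ∃ b ≥ 0, ∀ (x : ℕ → ℝ) (N : ℕ), N ≠ 0 → ∀ z ∈ C,
      ((k * ‖z‖ - b * (1 + (∑ i ∈ Finset.range N, |x i|) / N) : ℝ) : EReal)
        ≤ programSAA x N a G z := by
  obtain ⟨k, hk, b, hb, hG⟩ := h.coercive
  refine ⟨k, hk, b, hb, fun x N hN z hz => ?_⟩
  have hN' : (N : ℝ) ≠ 0 := Nat.cast_ne_zero.2 hN
  have h1 := add_le_add_right (sampleMean_mono (x := x) (N := N) (g' := G z)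
    (g := fun y => ((k * ‖z‖ - b * (1 + |y|) - a z : ℝ) : EReal)) fun i => hG z hz (x i))
    (a z : EReal)
  rw [sampleMean_coe x N fun y => k * ‖z‖ - b * (1 + |y|) - a z, ← EReal.coe_add] at h1
  refine le_of_eq_of_le (congrArg _ ?_) h1
  simp only [Finset.sum_sub_distrib, ← Finset.mul_sum, Finset.sum_add_distrib, Finset.sum_const,
    Finset.card_range, nsmul_eq_mul]
  field_simp
  ring

theorem coercive_programSAA (h : IsCoerciveProgram C a G) (x : ℕ → ℝ) {N : ℕ} (hN : N ≠ 0)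
    (M : ℝ) : ∃ R : ℝ, ∀ z ∈ C, R < ‖z‖ → (M : EReal) < programSAA x N a G z := by
  obtain ⟨k, hk, b, hb, hG⟩ := h.exists_programSAA_ge
  refine ⟨(M + b * (1 + (∑ i ∈ Finset.range N, |x i|) / N)) / k, fun z hz hR => ?_⟩
  refine lt_of_lt_of_le (EReal.coe_lt_coe_iff.2 ?_) (hG x N hN z hz)
  rw [div_lt_iff₀' hk] at hR
  linarith

theorem eventually_coercive_programSAA (h : IsCoerciveProgram C a G) {x : ℕ → ℝ} {m : ℝ}
    (hx : Tendsto (fun N : ℕ => (∑ i ∈ Finset.range N, |x i|) / N) atTop (𝓝 m)) (M : ℝ) :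
    ∃ R : ℝ, ∀ᶠ N : ℕ in atTop, ∀ z ∈ C, R < ‖z‖ → (M : EReal) < programSAA x N a G z := by
  obtain ⟨k, hk, b, hb, hG⟩ := h.exists_programSAA_ge
  refine ⟨(M + b * (1 + (m + 1))) / k, ?_⟩
  filter_upwards [hx.eventually_lt_const (lt_add_one m), eventually_ne_atTop 0]
    with N hN hN0 z hz hR
  refine lt_of_lt_of_le (EReal.coe_lt_coe_iff.2 ?_) (hG x N hN0 z hz)
  rw [div_lt_iff₀' hk] at hR
  have := mul_le_mul_of_nonneg_left hN.le hb
  linarith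

theorem coercive_programObj [IsProbabilityMeasure P] (h : IsCoerciveProgram C a G)
    (hX : Integrable X P) (M : ℝ) :
    ∃ R : ℝ, ∀ z ∈ C, R < ‖z‖ → (M : EReal) < programObj P X a G z := by
  obtain ⟨k, hk, b, hb, hG⟩ := h.coercive
  refine ⟨(M + b * (1 + ∫ ω, |X ω| ∂P)) / k, fun z hz hR => ?_⟩
  have hi : Integrable (fun ω => k * ‖z‖ - b * (1 + |X ω|) - a z) P :=
    ((integrable_const _).sub (((integrable_const _).add hX.abs).const_mul b)).sub
      (integrable_const _)
  have h1 := add_le_add_right (extExp_mono (P := P) fun ω => hG z hz (X ω)) (a z : EReal)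
  rw [extExp_coe hi, ← EReal.coe_add] at h1
  refine lt_of_lt_of_le (EReal.coe_lt_coe_iff.2 ?_) h1
  have h2 : ∫ ω, (k * ‖z‖ - b * (1 + |X ω|) - a z) ∂P
      = k * ‖z‖ - b * (1 + ∫ ω, |X ω| ∂P) - a z := by
    have h3 : ∀ ω, k * ‖z‖ - b * (1 + |X ω|) - a z = (k * ‖z‖ - b - a z) - b * |X ω| :=
      fun ω => by ring
    simp_rw [h3]
    rw [integral_sub (integrable_const _) (hX.abs.const_mul b), integral_const_mul]
    simp
    ring
  rw [div_lt_iff₀' hk] at hR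
  linarith

/-- By Fatou's lemma the objective inherits lower semicontinuity from the integrand. -/
theorem lowerSemicontinuousOn_programObj [IsProbabilityMeasure P] (h : IsCoerciveProgram C a G)
    (hX : Integrable X P) (hG : ∀ y, LowerSemicontinuousOn (fun z => G z y) C) :
    LowerSemicontinuousOn (programObj P X a G) C := by
  refine lowerSemicontinuousOn_ereal_add
    ((continuous_coe_real_ereal.comp h.continuous).lowerSemicontinuous.lowerSemicontinuousOn C) ?_
  obtain ⟨k, hk, b, hb, hle⟩ := h.coercive
  intro z hz β hβ
  by_contra hcon
  obtain ⟨α, hβα, hα⟩ := EReal.lt_iff_exists_real_btwn.1 hβ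
  -- near `z` the function `a` is bounded, which gives a lower bound uniform along a sequence
  have hbd : ∀ᶠ z' in 𝓝[C] z, a z' < a z + 1 :=
    (h.continuous.continuousAt.eventually_lt_const (lt_add_one (a z))).filter_mono
      nhdsWithin_le_nhds
  obtain ⟨u, hu, hu'⟩ := exists_seq_forall_of_frequently
    ((not_eventually.1 hcon).and_eventually (hbd.and self_mem_nhdsWithin))
  have hlow : ∀ z' ∈ C, a z' < a z + 1 → ∀ y,
      ((-(b * (1 + |y|) + |a z + 1|) : ℝ) : EReal) ≤ G z' y := by
    intro z' hz' ha y
    refine le_trans (EReal.coe_le_coe_iff.2 ?_) (hle z' hz' y)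
    have := le_abs_self (a z + 1)
    have := mul_nonneg hk.le (norm_nonneg z')
    linarith
  have hmeas : ∀ z' ∈ C, AEMeasurable (fun ω => G z' (X ω)) P := fun z' hz' =>
    (h.measurable z' hz').comp_aemeasurable hX.aemeasurable
  refine absurd hα (not_lt.2 ?_)
  refine extExp_le_of_le_liminf (ℓ := fun ω => b * (1 + |X ω|) + |a z + 1|)
    (g_ := fun n ω => G (u n) (X ω)) (fun n => hmeas _ (hu' n).2.2) (hmeas z hz)
    ((((integrable_const _).add hX.abs).const_mul b).add (integrable_const _))
    (fun ω => by positivity) (fun n ω => hlow _ (hu' n).2.2 (hu' n).2.1 _)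
    (fun ω => hlow z hz (lt_add_one _) _) (fun ω γ hγ => ?_)
    (fun n => (not_lt.1 (hu' n).1).trans hβα.le)
  exact hu.eventually (hG (X ω) z hz γ hγ)

theorem ae_tendsto_programSAA {Ω' : Type*} [MeasurableSpace Ω'] {μ : Measure Ω'}
    [IsFiniteMeasure P] {ξ : ℕ → Ω' → ℝ} (h : IsCoerciveProgram C a G) (hX : Integrable X P)
    (hindep : iIndepFun ξ μ) (hident : ∀ i, IdentDistrib (ξ i) X μ P) {c : E} (hc : c ∈ C) :
    ∀ᵐ ω ∂μ, Tendsto (fun N : ℕ => programSAA (fun i => ξ i ω) N a G c) atTop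
      (𝓝 (programObj P X a G c)) := by
  obtain ⟨k, hk, b, hb, hle⟩ := h.coercive
  filter_upwards [tendsto_sampleMean hindep hident (h.measurable c hc)
    (ℓ := fun y => b * (1 + |y|) + |a c|) (fun y => by positivity)
    ((((integrable_const _).add hX.abs).const_mul b).add (integrable_const _))
    (fun y => (EReal.coe_le_coe_iff.2 (by
      have := le_abs_self (a c)
      have := mul_nonneg hk.le (norm_nonneg c)
      linarith)).trans (hle c hc y))] with ω hω
  exact tendsto_ereal_const_add _ hω

/-- A lower bound `β` for the objective near `z` passes, up to an arbitrarily small loss, to the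
sample average approximations on a neighborhood of `z` that does not depend on the sample size. -/
theorem eventually_lt_programSAA (h : IsCoerciveProgram C a G) {x : ℕ → ℝ} {D : Set E}
    (hD : Dense D) (hx : ∀ c ∈ D ∩ C,
      Tendsto (fun N => programSAA x N a G c) atTop (𝓝 (programObj P X a G c)))
    {z : E} (hz : z ∈ C) {α β : ℝ} (hαβ : α < β)
    (hβ : ∀ᶠ c in 𝓝[C] z, (β : EReal) < programObj P X a G c) :
    ∃ U ∈ 𝓝[C] z, ∀ᶠ N in atTop, ∀ z' ∈ U, (α : EReal) < programSAA x N a G z' := by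
  obtain ⟨W, hWo, hzW, hWC, hW⟩ := h.minorant z hz
  set δ := (β - α) / 2 with hδ
  have hδ0 : 0 < δ := by rw [hδ]; linarith
  have hup : ∀ᶠ c in 𝓝[C] z, a c < a z + δ :=
    (h.continuous.continuousAt.eventually_lt_const (by linarith)).filter_mono nhdsWithin_le_nhds
  have hdown : ∀ᶠ c in 𝓝[C] z, a z - δ < a c :=
    (h.continuous.continuousAt.eventually_const_lt (by linarith)).filter_mono nhdsWithin_le_nhds
  obtain ⟨V, hV, hzV, hVC⟩ := mem_nhdsWithin.1 (hβ.and hup)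
  obtain ⟨c, hcD, hcVW⟩ := hD.exists_mem_open (hV.inter hWo) (mem_closure_iff.1 hzW V hV hzV)
  have hcC := hWC hcVW.2
  obtain ⟨hcβ, hca⟩ := hVC ⟨hcVW.1, hcC⟩
  refine ⟨_, hdown.and (hW c hcVW.2), ?_⟩
  filter_upwards [(hx c ⟨hcD, hcC⟩).eventually_const_lt hcβ] with N hN z' hz'
  have h1 : sampleMean x N (G c) ≤ sampleMean x N (G z') := sampleMean_mono fun i => hz'.2 _
  have h2 := hz'.1
  unfold programSAA at hN ⊢
  generalize sampleMean x N (G c) = s at *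
  generalize sampleMean x N (G z') = t at *
  induction t with
  | bot =>
    rw [le_bot_iff.1 h1] at hN
    simp at hN
  | top => simp
  | coe t =>
    induction s with
    | bot => simp at hN
    | top => simp at h1
    | coe s =>
      norm_cast at hN h1 ⊢
      linarith

variable {Ω' : Type*} [MeasurableSpace Ω'] {μ : Measure Ω'} {ξ : ℕ → Ω' → ℝ}

theorem ae_tendsto_mean_abs (hX : Integrable X P) (hindep : iIndepFun ξ μ)
    (hident : ∀ i, IdentDistrib (ξ i) X μ P) :
    ∀ᵐ ω ∂μ, Tendsto (fun N : ℕ => (∑ i ∈ Finset.range N, |ξ i ω|) / N) atTop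
      (𝓝 (∫ ω, |X ω| ∂P)) := by
  filter_upwards [tendsto_sampleMean_coe hindep hident (h := fun y => |y|) (by fun_prop) hX.abs]
    with ω hω
  simp only [sampleMean_coe] at hω
  exact EReal.tendsto_coe.1 hω

/-- Almost sure convergence of the optimal values. Lower semicontinuity of the integrand is not
needed: the minorants `G c` come from feasible points `c`, where the objective is at least the
optimal value. -/
theorem ae_tendsto_optVal [ProperSpace E] [IsProbabilityMeasure P] (h : IsCoerciveProgram C a G)
    (hX : Integrable X P) (hindep : iIndepFun ξ μ) (hident : ∀ i, IdentDistrib (ξ i) X μ P) :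
    ∀ᵐ ω ∂μ, Tendsto (fun N : ℕ => optVal C (programSAA (fun i => ξ i ω) N a G)) atTop
      (𝓝 (optVal C (programObj P X a G))) := by
  obtain ⟨D, hDc, hD⟩ := TopologicalSpace.exists_countable_dense E
  have hval : optVal C (programObj P X a G) = sInf (programObj P X a G '' C) := by
    rw [sInf_image]; rfl
  obtain ⟨v, -, hv, hvmem⟩ := exists_seq_tendsto_sInf (h.nonempty.image (programObj P X a G))
    (OrderBot.bddBelow _)
  choose u huC hu using hvmem
  filter_upwards [ae_tendsto_mean_abs hX hindep hident,
    (ae_ball_iff (hDc.mono Set.inter_subset_left)).2 fun c (hc : c ∈ D ∩ C) =>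
      h.ae_tendsto_programSAA hX hindep hident hc.2,
    ae_all_iff.2 fun n => h.ae_tendsto_programSAA hX hindep hident (huC n)] with ω hω hωD hωu
  refine tendsto_order.2 ⟨fun α hα => ?_, fun β hβ => ?_⟩
  · obtain ⟨γ, hαγ, hγ⟩ := EReal.lt_iff_exists_real_btwn.1 hα
    obtain ⟨β, hγβ, hβ⟩ := EReal.lt_iff_exists_real_btwn.1 hγ
    rw [EReal.coe_lt_coe_iff] at hγβ
    obtain ⟨R, hR⟩ := h.eventually_coercive_programSAA hω γ
    have hK := IsCompact.eventually_forall_of_local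
      ((isCompact_closedBall (0 : E) R).inter_left h.isClosed) Set.inter_subset_left
      (Q := fun N z => (γ : EReal) < programSAA (fun i => ξ i ω) N a G z)
      fun z hz => h.eventually_lt_programSAA hD hωD hz.1 hγβ (by
        filter_upwards [self_mem_nhdsWithin] with c hc
        exact hβ.trans_le (iInf₂_le c hc))
    filter_upwards [hR, hK] with N h1 h2
    refine hαγ.trans_le (le_iInf₂ fun z hz => ?_)
    by_cases hzR : R < ‖z‖
    · exact (h1 z hz hzR).le
    · exact (h2 z ⟨hz, mem_closedBall_zero_iff.2 (not_lt.1 hzR)⟩).le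
  · rw [hval] at hβ
    obtain ⟨n, hn⟩ := (hv.eventually_lt_const hβ).exists
    rw [← hu n] at hn
    filter_upwards [(hωu n).eventually_lt_const hn] with N hN
    exact (iInf₂_le (u n) (huC n)).trans_lt hN

theorem optSol_programObj_nonempty [ProperSpace E] [IsProbabilityMeasure P]
    (h : IsCoerciveProgram C a G) (hX : Integrable X P)
    (hG : ∀ y, LowerSemicontinuousOn (fun z => G z y) C) :
    (optSol C (programObj P X a G)).Nonempty :=
  optSol_nonempty_of_lowerSemicontinuousOn h.isClosed h.nonempty
    (h.lowerSemicontinuousOn_programObj hX hG) (h.coercive_programObj hX)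

theorem optSol_programSAA_nonempty [ProperSpace E] (h : IsCoerciveProgram C a G)
    (hG : ∀ y, LowerSemicontinuousOn (fun z => G z y) C) (x : ℕ → ℝ) {N : ℕ} (hN : N ≠ 0) :
    (optSol C (programSAA x N a G)).Nonempty :=
  optSol_nonempty_of_lowerSemicontinuousOn h.isClosed h.nonempty
    (lowerSemicontinuousOn_ereal_add
      ((continuous_coe_real_ereal.comp h.continuous).lowerSemicontinuous.lowerSemicontinuousOn C)
      (lowerSemicontinuousOn_sampleMean hG x hN)) (h.coercive_programSAA x hN)

/-- Almost sure convergence of the solution sets. On the compact set of feasible points in a ball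
at distance at least `ε` from the solutions, the objective exceeds its minimum, hence so do
eventually the sample averages, uniformly. -/
theorem ae_tendsto_setDev [ProperSpace E] [IsProbabilityMeasure P] (h : IsCoerciveProgram C a G)
    (hX : Integrable X P) (hindep : iIndepFun ξ μ) (hident : ∀ i, IdentDistrib (ξ i) X μ P)
    (hG : ∀ y, LowerSemicontinuousOn (fun z => G z y) C) :
    ∀ᵐ ω ∂μ, Tendsto (fun N : ℕ => setDev (optSol C (programSAA (fun i => ξ i ω) N a G))
      (optSol C (programObj P X a G))) atTop (𝓝 0) := by
  obtain ⟨D, hDc, hD⟩ := TopologicalSpace.exists_countable_dense E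
  obtain ⟨z₀, hz₀⟩ := h.optSol_programObj_nonempty hX hG
  have hlsc := h.lowerSemicontinuousOn_programObj hX hG
  filter_upwards [ae_tendsto_mean_abs hX hindep hident,
    (ae_ball_iff (hDc.mono Set.inter_subset_left)).2 fun c (hc : c ∈ D ∩ C) =>
      h.ae_tendsto_programSAA hX hindep hident hc.2,
    h.ae_tendsto_programSAA hX hindep hident hz₀.1] with ω hω hωD hωz
  refine ENNReal.tendsto_nhds_zero.2 fun ε hε => ?_
  rcases (le_top (a := programObj P X a G z₀)).lt_or_eq with hlt | htop
  · obtain ⟨M, hM, -⟩ := EReal.lt_iff_exists_real_btwn.1 hlt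
    obtain ⟨R, hR⟩ := h.eventually_coercive_programSAA hω M
    have hfar : IsClosed {z : E | ε ≤ Metric.infEDist z (optSol C (programObj P X a G))} :=
      isClosed_le continuous_const Metric.continuous_infEDist
    have hK := IsCompact.eventually_forall_of_local (C := C)
      (((isCompact_closedBall (0 : E) R).inter_left h.isClosed).inter_right hfar)
      (fun z hz => hz.1.1)
      (Q := fun N z => programSAA (fun i => ξ i ω) N a G z₀ < programSAA (fun i => ξ i ω) N a G z)
      fun z hz => by
        have hzS : z ∉ optSol C (programObj P X a G) := fun hmem => by
          have := hz.2
          rw [Set.mem_ofPred_eq, Metric.infEDist_zero_of_mem hmem] at this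
          exact absurd hε (not_lt.2 this)
        have hzlt : programObj P X a G z₀ < programObj P X a G z := by
          by_contra! hle
          exact hzS ⟨hz.1.1, fun y hy => hle.trans (hz₀.2 y hy)⟩
        obtain ⟨α, hα, hα'⟩ := EReal.lt_iff_exists_real_btwn.1 hzlt
        obtain ⟨β, hαβ, hβ⟩ := EReal.lt_iff_exists_real_btwn.1 hα'
        obtain ⟨U, hU, hUN⟩ := h.eventually_lt_programSAA hD hωD hz.1.1
          (EReal.coe_lt_coe_iff.1 hαβ) (hlsc z hz.1.1 β hβ)
        refine ⟨U, hU, ?_⟩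
        filter_upwards [hUN, hωz.eventually_lt_const hα] with N h1 h2 z' hz'
        exact h2.trans (h1 z' hz')
    filter_upwards [hR, hK, hωz.eventually_lt_const hM] with N h1 h2 h3
    refine iSup₂_le fun z hz => ?_
    by_contra! hlt
    by_cases hzR : R < ‖z‖
    · exact absurd (hz.2 z₀ hz₀.1) (not_le.2 (h3.trans (h1 z hz.1 hzR)))
    · exact absurd (hz.2 z₀ hz₀.1) (not_le.2
        (h2 z ⟨⟨hz.1, mem_closedBall_zero_iff.2 (not_lt.1 hzR)⟩, hlt.le⟩))
  · -- if the objective is identically `⊤`, every feasible point is a solution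
    filter_upwards with N
    refine iSup₂_le fun z hz => ?_
    have hzS : z ∈ optSol C (programObj P X a G) := by
      refine ⟨hz.1, fun y hy => ?_⟩
      have := hz₀.2 y hy
      rw [htop, top_le_iff] at this
      rw [this]
      exact le_top
    rw [Metric.infEDist_zero_of_mem hzS]
    exact zero_le

end IsCoerciveProgram

end Program

/-! ### Convex functions above the identity and their perspectives -/

section Perspective

variable {φ φ₁ φ₂ : ℝ → ℝ}

theorem continuous_of_convexOn_univ (hconv : ConvexOn ℝ Set.univ φ) : Continuous φ :=
  continuousOn_univ.1 (hconv.continuousOn isOpen_univ)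

/-- A convex function that meets the identity only at `0` lies above it by a linear amount. -/
theorem exists_linear_growth (hmono : Monotone φ) (hconv : ConvexOn ℝ Set.univ φ)
    (hzero : φ 0 = 0) (hgt : ∀ s, s ≠ 0 → s < φ s) :
    ∃ c, 0 < c ∧ c ≤ 1 ∧ ∀ κ, 0 ≤ κ → κ ≤ c → ∀ s, s + κ * (|s| - 1) ≤ φ s := by
  have h1 := hgt 1 one_ne_zero
  have h2 := hgt (-1) (by norm_num)
  have h3 : φ (-1) ≤ 0 := hzero ▸ hmono (by norm_num : (-1 : ℝ) ≤ 0)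
  refine ⟨min (φ 1 - 1) (φ (-1) + 1), lt_min (by linarith) (by linarith),
    (min_le_right _ _).trans (by linarith), fun κ hκ hκc s => ?_⟩
  have hκ1 := hκc.trans (min_le_left _ _)
  have hκ2 := hκc.trans (min_le_right _ _)
  have hge : s ≤ φ s := by
    rcases eq_or_ne s 0 with rfl | hs
    · exact hzero.ge
    · exact (hgt s hs).le
  -- convexity along the ray from `0` through `p = ±1`
  have hray : ∀ p t : ℝ, 1 ≤ t → t * φ p ≤ φ (t * p) := by
    intro p t ht
    have ht0 : 0 < t := by linarith
    have := hconv.2 (Set.mem_univ (t * p)) (Set.mem_univ 0) (inv_nonneg.2 ht0.le)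
      (sub_nonneg.2 (inv_le_one_of_one_le₀ ht)) (by ring)
    simp only [smul_eq_mul, mul_zero, add_zero, hzero] at this
    rw [inv_mul_cancel_left₀ ht0.ne', inv_mul_eq_div, le_div_iff₀ ht0] at this
    linarith
  rcases le_or_gt |s| 1 with hs | hs
  · have := mul_nonneg hκ (sub_nonneg.2 hs)
    linarith
  · rcases le_total 0 s with h0 | h0
    · rw [abs_of_nonneg h0] at hs ⊢
      have h4 := hray 1 s hs.le
      rw [mul_one] at h4
      have := mul_le_mul_of_nonneg_right hκ1 h0
      linarith
    · rw [abs_of_nonpos h0] at hs ⊢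
      have h4 := hray (-1) (-s) hs.le
      rw [neg_mul_neg, mul_one] at h4
      have := mul_le_mul_of_nonneg_right hκ2 (neg_nonneg.2 h0)
      linarith

theorem persp_one (φ : ℝ → ℝ) (s : ℝ) : persp φ 1 s = (φ s : EReal) := by
  simp [persp]

theorem persp_mono (hmono : Monotone φ) {lam : ℝ} (hlam : 0 ≤ lam) : Monotone (persp φ lam) := by
  intro s t hst
  unfold persp
  split_ifs with h0 hs ht ht
  · exact le_rfl
  · exact le_top
  · exact absurd (hst.trans ht) hs
  · exact le_rfl
  · exact EReal.coe_le_coe_iff.2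
      (mul_le_mul_of_nonneg_left (hmono (div_le_div_of_nonneg_right hst hlam)) hlam)

/-- The perspective of a convex function vanishing at `0` is nonincreasing in the scale, also
across the scale `0`. -/
theorem persp_antitone (hmono : Monotone φ) (hconv : ConvexOn ℝ Set.univ φ) (hzero : φ 0 = 0)
    {lam lam' : ℝ} (hlam : 0 ≤ lam) (hle : lam ≤ lam') (s : ℝ) :
    persp φ lam' s ≤ persp φ lam s := by
  rcases hlam.eq_or_lt with rfl | hpos
  · by_cases hs : s ≤ 0
    · by_cases h' : lam' = 0
      · rw [h']
      · simp only [persp, h', if_false, if_true, hs]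
        refine EReal.coe_nonpos.2 (mul_nonpos_of_nonneg_of_nonpos hle ?_)
        exact hzero ▸ hmono (div_nonpos_of_nonpos_of_nonneg hs hle)
    · simp [persp, hs]
  · have hpos' := hpos.trans_le hle
    simp only [persp, hpos.ne', hpos'.ne', if_false]
    refine EReal.coe_le_coe_iff.2 ?_
    have := hconv.2 (Set.mem_univ (s / lam)) (Set.mem_univ 0) (div_nonneg hpos.le hpos'.le)
      (sub_nonneg.2 ((div_le_one hpos').2 hle)) (by ring)
    simp only [smul_eq_mul, mul_zero, add_zero, hzero] at this
    rw [show lam / lam' * (s / lam) = s / lam' by field_simp] at this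
    calc lam' * φ (s / lam') ≤ lam' * (lam / lam' * φ (s / lam)) :=
          mul_le_mul_of_nonneg_left this hpos'.le
      _ = lam * φ (s / lam) := by field_simp

theorem le_persp {κ : ℝ} (hκ1 : κ ≤ 1) (hφ : ∀ s, s + κ * (|s| - 1) ≤ φ s) {lam : ℝ}
    (hlam : 0 ≤ lam) (s : ℝ) : ((s + κ * (|s| - lam) : ℝ) : EReal) ≤ persp φ lam s := by
  rcases hlam.eq_or_lt with rfl | hpos
  · by_cases hs : s ≤ 0
    · simp only [persp, if_true, hs, abs_of_nonpos hs]
      refine EReal.coe_nonpos.2 ?_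
      nlinarith
    · simp [persp, hs]
  · simp only [persp, hpos.ne', if_false]
    refine EReal.coe_le_coe_iff.2 ?_
    have h1 := mul_le_mul_of_nonneg_left (hφ (s / lam)) hpos.le
    rw [abs_div, abs_of_pos hpos] at h1
    refine le_of_eq_of_le ?_ h1
    field_simp

/-- The integrand of the ball-constrained problem, with its affine part, dominates a multiple of
the norm of `(θ₁, θ₂, lam)` up to an affine function of `|y|`. With `u = θ₂ - y` and
`w = φ₁ u - u ≥ 0` it is at least `-y + w + κ |u + w + θ₁| + lam (r - κ)`; a small `κ` lets `w`
absorb what the triangle inequality costs. -/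
theorem exists_persp_coercive (hmono₁ : Monotone φ₁) (hmono₂ : Monotone φ₂)
    (hconv₁ : ConvexOn ℝ Set.univ φ₁) (hconv₂ : ConvexOn ℝ Set.univ φ₂)
    (hzero₁ : φ₁ 0 = 0) (hzero₂ : φ₂ 0 = 0)
    (hgt₁ : ∀ s, s ≠ 0 → s < φ₁ s) (hgt₂ : ∀ s, s ≠ 0 → s < φ₂ s) {r : ℝ} (hr : 0 < r) :
    ∃ k > 0, ∃ b ≥ 0, ∀ θ₁ θ₂ lam y : ℝ, 0 ≤ lam →
      ((k * (|θ₁| + |θ₂| + lam) - b * (1 + |y|) - (-θ₁ - θ₂ + lam * r) : ℝ) : EReal)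
        ≤ persp φ₂ lam (φ₁ (θ₂ - y) + θ₁) := by
  obtain ⟨c₁, hc₁, -, hφ₁⟩ := exists_linear_growth hmono₁ hconv₁ hzero₁ hgt₁
  obtain ⟨c₂, hc₂, -, hφ₂⟩ := exists_linear_growth hmono₂ hconv₂ hzero₂ hgt₂
  obtain ⟨κ, hκ, hκ₁, hκ₂, hκr, hκh⟩ : ∃ κ, 0 < κ ∧ κ ≤ c₁ / 4 ∧ κ ≤ c₂ ∧ κ ≤ r / 2 ∧ κ ≤ 1 / 2 :=
    ⟨min (min (c₁ / 4) c₂) (min (r / 2) (1 / 2)),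
      lt_min (lt_min (by linarith) hc₂) (lt_min (by linarith) (by norm_num)),
      (min_le_left _ _).trans (min_le_left _ _), (min_le_left _ _).trans (min_le_right _ _),
      (min_le_right _ _).trans (min_le_left _ _), (min_le_right _ _).trans (min_le_right _ _)⟩
  refine ⟨κ, hκ, 1 + κ + c₁, by positivity, fun θ₁ θ₂ lam y hlam => ?_⟩
  refine le_trans (EReal.coe_le_coe_iff.2 ?_)
    (le_persp (by linarith) (hφ₂ κ hκ.le hκ₂) hlam (φ₁ (θ₂ - y) + θ₁))
  have hw0 := hφ₁ 0 le_rfl hc₁.le (θ₂ - y)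
  have hw := hφ₁ c₁ hc₁.le le_rfl (θ₂ - y)
  have hu : |θ₂| - |y| ≤ |θ₂ - y| := abs_sub_abs_le_abs_sub _ _
  set u := θ₂ - y with hu_def
  obtain ⟨w, hw_def⟩ : ∃ w, w = φ₁ u - u := ⟨_, rfl⟩
  have hφu : φ₁ u = u + w := by linarith
  rw [hφu] at hw hw0 ⊢
  have hw0' : 0 ≤ w := by linarith
  have hs : |θ₁| - w - |u| ≤ |u + w + θ₁| := by
    have h1 := abs_sub_abs_le_abs_sub θ₁ (-(u + w))
    rw [abs_neg, show θ₁ - -(u + w) = u + w + θ₁ by ring] at h1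
    have h2 := abs_add_le u w
    rw [abs_of_nonneg hw0'] at h2
    linarith
  have e1 := mul_le_mul_of_nonneg_left hs hκ.le
  have e2 := mul_le_mul_of_nonneg_right hκh hw0'
  have e3 := mul_le_mul_of_nonneg_right hκ₁ (abs_nonneg u)
  have e4 := mul_le_mul_of_nonneg_left hu hκ.le
  have e5 := mul_le_mul_of_nonneg_right hκr hlam
  have e6 := le_abs_self y
  have e7 := mul_nonneg hc₁.le (abs_nonneg y)
  have hθ : θ₂ = u + y := by rw [hu_def]; ring
  have e8 : -θ₁ - θ₂ = -θ₁ - u - y := by rw [hθ]; ring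
  rw [e8]
  linarith

end Perspective

/-! ### The penalized and the ball-constrained problem -/

section Duals

variable {φ₁ φ₂ : ℝ → ℝ}

theorem isCoerciveProgram_ball (hmono₁ : Monotone φ₁) (hmono₂ : Monotone φ₂)
    (hconv₁ : ConvexOn ℝ Set.univ φ₁) (hconv₂ : ConvexOn ℝ Set.univ φ₂)
    (hzero₁ : φ₁ 0 = 0) (hzero₂ : φ₂ 0 = 0)
    (hgt₁ : ∀ s, s ≠ 0 → s < φ₁ s) (hgt₂ : ∀ s, s ≠ 0 → s < φ₂ s) {r : ℝ} (hr : 0 < r) :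
    IsCoerciveProgram ballFeas (fun z : ℝ × ℝ × ℝ => -z.1 - z.2.1 + z.2.2 * r)
      (fun z y => persp φ₂ z.2.2 (φ₁ (z.2.1 - y) + z.1)) where
  isClosed := isClosed_le continuous_const (by fun_prop)
  nonempty := ⟨0, le_refl (0 : ℝ)⟩
  continuous := by fun_prop
  measurable z hz := by
    have := hmono₁.measurable
    exact (persp_mono hmono₂ hz).measurable.comp (by fun_prop)
  coercive := by
    obtain ⟨k, hk, b, hb, h⟩ :=
      exists_persp_coercive hmono₁ hmono₂ hconv₁ hconv₂ hzero₁ hzero₂ hgt₁ hgt₂ hr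
    refine ⟨k, hk, b, hb, fun z hz y => ?_⟩
    refine le_trans (EReal.coe_le_coe_iff.2 ?_) (h z.1 z.2.1 z.2.2 y hz)
    have hz' : |z.2.2| = z.2.2 := abs_of_nonneg hz
    have hnorm : ‖z‖ ≤ |z.1| + |z.2.1| + z.2.2 := by
      rw [Prod.norm_def, Prod.norm_def, Real.norm_eq_abs, Real.norm_eq_abs, Real.norm_eq_abs, hz']
      have := abs_nonneg z.1
      have := abs_nonneg z.2.1
      have : (0 : ℝ) ≤ z.2.2 := hz
      refine max_le (by linarith) (max_le (by linarith) (by linarith))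
    have := mul_le_mul_of_nonneg_left hnorm hk.le
    linarith
  minorant z hz := by
    refine ⟨Set.Iio z.1 ×ˢ Set.Iio z.2.1 ×ˢ Set.Ioi z.2.2,
      isOpen_Iio.prod (isOpen_Iio.prod isOpen_Ioi), ?_, ?_, ?_⟩
    · simp [closure_prod_eq]
    · exact fun c hc => le_trans (show (0 : ℝ) ≤ z.2.2 from hz) (le_of_lt hc.2.2)
    · intro c hc
      have h1 : ∀ᶠ z' in 𝓝[ballFeas] z, c.1 < z'.1 :=
        (continuous_fst.continuousAt.eventually_const_lt hc.1).filter_mono nhdsWithin_le_nhds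
      have h2 : ∀ᶠ z' : ℝ × ℝ × ℝ in 𝓝[ballFeas] z, c.2.1 < z'.2.1 :=
        ((continuous_fst.comp continuous_snd).continuousAt.eventually_const_lt
          hc.2.1).filter_mono nhdsWithin_le_nhds
      have h3 : ∀ᶠ z' : ℝ × ℝ × ℝ in 𝓝[ballFeas] z, z'.2.2 < c.2.2 :=
        ((continuous_snd.comp continuous_snd).continuousAt.eventually_lt_const
          hc.2.2).filter_mono nhdsWithin_le_nhds
      filter_upwards [h1, h2, h3, self_mem_nhdsWithin] with z' h1 h2 h3 (h0 : 0 ≤ z'.2.2) y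
      refine (persp_antitone hmono₂ hconv₂ hzero₂ h0 h3.le _).trans (persp_mono hmono₂ h0 ?_)
      exact add_le_add (hmono₁ (by linarith)) h1.le

theorem isCoerciveProgram_pen (hmono₁ : Monotone φ₁) (hmono₂ : Monotone φ₂)
    (hconv₁ : ConvexOn ℝ Set.univ φ₁) (hconv₂ : ConvexOn ℝ Set.univ φ₂)
    (hzero₁ : φ₁ 0 = 0) (hzero₂ : φ₂ 0 = 0)
    (hgt₁ : ∀ s, s ≠ 0 → s < φ₁ s) (hgt₂ : ∀ s, s ≠ 0 → s < φ₂ s) :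
    IsCoerciveProgram Set.univ (fun θ : ℝ × ℝ => -θ.1 - θ.2)
      (fun θ y => ((φ₂ (φ₁ (θ.2 - y) + θ.1) : ℝ) : EReal)) where
  isClosed := isClosed_univ
  nonempty := Set.univ_nonempty
  continuous := by fun_prop
  measurable z _ := by
    have := hmono₁.measurable
    have := hmono₂.measurable
    fun_prop
  coercive := by
    -- the penalized integrand is the ball-constrained one at `lam = 1`, here with radius `1`
    obtain ⟨k, hk, b, hb, h⟩ :=
      exists_persp_coercive hmono₁ hmono₂ hconv₁ hconv₂ hzero₁ hzero₂ hgt₁ hgt₂ one_pos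
    refine ⟨k, hk, b + 1, by positivity, fun z _ y => ?_⟩
    rw [← persp_one φ₂]
    refine le_trans (EReal.coe_le_coe_iff.2 ?_) (h z.1 z.2 1 y zero_le_one)
    have hnorm : ‖z‖ ≤ |z.1| + |z.2| + 1 := by
      rw [Prod.norm_def, Real.norm_eq_abs, Real.norm_eq_abs]
      have := abs_nonneg z.1
      have := abs_nonneg z.2
      exact max_le (by linarith) (by linarith)
    have := mul_le_mul_of_nonneg_left hnorm hk.le
    have := abs_nonneg y
    linarith
  minorant z _ := by
    refine ⟨Set.Iio z.1 ×ˢ Set.Iio z.2, isOpen_Iio.prod isOpen_Iio, ?_, Set.subset_univ _, ?_⟩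
    · simp [closure_prod_eq]
    · intro c hc
      rw [nhdsWithin_univ]
      filter_upwards [continuous_fst.continuousAt.eventually_const_lt hc.1,
        continuous_snd.continuousAt.eventually_const_lt hc.2] with z' h1 h2 y
      exact EReal.coe_le_coe_iff.2 (hmono₂ (add_le_add (hmono₁ (by linarith)) h1.le))

end Duals

theorem theorem4 {Ω Ω' : Type*} [MeasurableSpace Ω] [MeasurableSpace Ω']
    (P₀ : Measure Ω) [IsProbabilityMeasure P₀] (μ : Measure Ω') [IsProbabilityMeasure μ]
    (X : Ω → ℝ) (hX : Integrable X P₀)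
    (ξ : ℕ → Ω' → ℝ) (hindep : iIndepFun ξ μ) (hident : ∀ i, IdentDistrib (ξ i) X μ P₀)
    (φ₁ φ₂ : ℝ → ℝ)
    (hmono₁ : Monotone φ₁) (hmono₂ : Monotone φ₂)
    (hconv₁ : ConvexOn ℝ Set.univ φ₁) (hconv₂ : ConvexOn ℝ Set.univ φ₂)
    (hzero₁ : φ₁ 0 = 0) (hzero₂ : φ₂ 0 = 0)
    (hgt₁ : ∀ s, s ≠ 0 → s < φ₁ s) (hgt₂ : ∀ s, s ≠ 0 → s < φ₂ s)
    (r : ℝ) (hr : 0 < r)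
    (hfin : ∃ z₀ ∈ ballFeas, ∀ᶠ z in 𝓝[ballFeas] z₀,
      extExp P₀ (fun ω => persp φ₂ z.2.2 (φ₁ (z.2.1 - X ω) + z.1)) < ⊤) :
    -- penalized problem: optimal values, then optimal solutions
    (∀ᵐ ω ∂μ, Tendsto
      (fun N : ℕ => optVal Set.univ (penObjSAA (fun i => ξ i ω) N φ₁ φ₂)) atTop
      (𝓝 (optVal Set.univ (penObj P₀ X φ₁ φ₂)))) ∧
    ((optSol Set.univ (penObj P₀ X φ₁ φ₂)).Nonempty ∧
      ∀ᵐ ω ∂μ,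
        (∀ᶠ N : ℕ in atTop,
          (optSol Set.univ (penObjSAA (fun i => ξ i ω) N φ₁ φ₂)).Nonempty) ∧
        Tendsto
          (fun N : ℕ => setDev (optSol Set.univ (penObjSAA (fun i => ξ i ω) N φ₁ φ₂))
            (optSol Set.univ (penObj P₀ X φ₁ φ₂))) atTop (𝓝 0)) ∧
    -- ball-constrained problem: optimal values, then optimal solutions
    (∀ᵐ ω ∂μ, Tendsto
      (fun N : ℕ => optVal ballFeas (ballObjSAA (fun i => ξ i ω) N φ₁ φ₂ r)) atTop
      (𝓝 (optVal ballFeas (ballObj P₀ X φ₁ φ₂ r)))) ∧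
    (LowerSemicontinuousOn (fun p : ℝ × ℝ => persp φ₂ p.1 p.2) {p | 0 ≤ p.1} →
      (optSol ballFeas (ballObj P₀ X φ₁ φ₂ r)).Nonempty ∧
      ∀ᵐ ω ∂μ,
        (∀ᶠ N : ℕ in atTop,
          (optSol ballFeas (ballObjSAA (fun i => ξ i ω) N φ₁ φ₂ r)).Nonempty) ∧
        Tendsto
          (fun N : ℕ => setDev (optSol ballFeas (ballObjSAA (fun i => ξ i ω) N φ₁ φ₂ r))
            (optSol ballFeas (ballObj P₀ X φ₁ φ₂ r))) atTop (𝓝 0)) := by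
  have hpen := isCoerciveProgram_pen hmono₁ hmono₂ hconv₁ hconv₂ hzero₁ hzero₂ hgt₁ hgt₂
  have hball := isCoerciveProgram_ball hmono₁ hmono₂ hconv₁ hconv₂ hzero₁ hzero₂ hgt₁ hgt₂ hr
  have hc₁ := continuous_of_convexOn_univ hconv₁
  have hc₂ := continuous_of_convexOn_univ hconv₂
  have hpenlsc : ∀ y : ℝ, LowerSemicontinuousOn
      (fun θ : ℝ × ℝ => ((φ₂ (φ₁ (θ.2 - y) + θ.1) : ℝ) : EReal)) Set.univ := fun y =>
    (continuous_coe_real_ereal.comp (by fun_prop)).lowerSemicontinuous.lowerSemicontinuousOn _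
  refine ⟨hpen.ae_tendsto_optVal hX hindep hident,
    ⟨hpen.optSol_programObj_nonempty hX hpenlsc, ?_⟩,
    hball.ae_tendsto_optVal hX hindep hident, fun hlsc => ?_⟩
  · filter_upwards [hpen.ae_tendsto_setDev hX hindep hident hpenlsc] with ω hω
    refine ⟨?_, hω⟩
    filter_upwards [eventually_ne_atTop 0] with N hN
    exact hpen.optSol_programSAA_nonempty hpenlsc _ hN
  · have hballlsc : ∀ y : ℝ, LowerSemicontinuousOn
        (fun z : ℝ × ℝ × ℝ => persp φ₂ z.2.2 (φ₁ (z.2.1 - y) + z.1)) ballFeas := fun y =>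
      hlsc.comp (g := fun z : ℝ × ℝ × ℝ => (z.2.2, φ₁ (z.2.1 - y) + z.1))
        (Continuous.continuousOn (by fun_prop)) fun z hz => hz
    refine ⟨hball.optSol_programObj_nonempty hX hballlsc, ?_⟩
    filter_upwards [hball.ae_tendsto_setDev hX hindep hident hballlsc] with ω hω
    refine ⟨?_, hω⟩
    filter_upwards [eventually_ne_atTop 0] with N hN
    exact hball.optSol_programSAA_nonempty hballlsc _ hN
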